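/- For $n\ge 4$, consider a convex $n$-gon with vertices labeled in cyclic order, and let $\mathcal{A}_n$ be the associahedron graph (flip graph): its vertices are the triangulations of the $n$-gon, that is, the sets of $n-3$ pairwise non-crossing diagonals, and two distinct triangulations are adjacent if and only if they share exactly $n-4$ diagonals. Let $\lambda_{\min}(G)$ denote the smallest eigenvalue of the adjacency matrix of a finite graph $G$. Then for all integers $k,\ell\ge 4$, $$\lambda_{\min}(\mathcal{A}_{k+\ell})\le \lambda_{\min}(\mathcal{A}_k)+\lambda_{\min}(\mathcal{A}_\ell).$$ Moreover, the limit $\displaystyle\lim_{n\to\infty}\frac{\lambda_{\min}(\mathcal{A}_n)}{n}$ exists (as a finite real number). -/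

import Mathlib

open Filter Topology

/-- A diagonal of the convex `n`-gon with vertices `0, 1, …, n - 1` in cyclic order: a pair
`i < j` of vertices that are not neighbours on the boundary of the polygon. -/
abbrev Diagonal (n : ℕ) : Type :=
  {p : Fin n × Fin n //
    (p.1 : ℕ) + 1 < (p.2 : ℕ) ∧ ¬ ((p.1 : ℕ) = 0 ∧ (p.2 : ℕ) + 1 = n)}

/-- Two diagonals of a convex polygon cross (meet in an interior point of both)
iff their endpoints are four distinct vertices that alternate along the boundary. -/
abbrev Diagonal.Crosses {n : ℕ} (d e : Diagonal n) : Prop :=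
  (d.1.1 < e.1.1 ∧ e.1.1 < d.1.2 ∧ d.1.2 < e.1.2) ∨
  (e.1.1 < d.1.1 ∧ d.1.1 < e.1.2 ∧ e.1.2 < d.1.2)

/-- Triangulations of the convex `n`-gon (`n ≥ 4`): sets of `n - 3` pairwise
non-crossing diagonals. -/
abbrev Triangulation (n : ℕ) : Type :=
  {T : Finset (Diagonal n) // T.card = n - 3 ∧ ∀ d ∈ T, ∀ e ∈ T, ¬ Diagonal.Crosses d e}

/-- The associahedron graph (flip graph) for `n ≥ 4`: two distinct triangulations of the convex
`n`-gon are adjacent iff they share exactly `n - 4` diagonals. -/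
def associahedronGraph (n : ℕ) : SimpleGraph (Triangulation n) where
  Adj S T := S ≠ T ∧ (S.1 ∩ T.1).card = n - 4
  symm := ⟨fun S T h => ⟨h.1.symm, by rw [Finset.inter_comm]; exact h.2⟩⟩
  loopless := ⟨fun _ h => h.1 rfl⟩

instance (n : ℕ) : DecidableRel (associahedronGraph n).Adj := fun S T =>
  inferInstanceAs (Decidable (S ≠ T ∧ (S.1 ∩ T.1).card = n - 4))

/-- The smallest eigenvalue of a finite graph, i.e. of its real adjacency matrix. For a graph with
at least one vertex the infimum is attained, see `lambdaMin_isLeast`. -/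
noncomputable def lambdaMin {V : Type*} [Fintype V] [DecidableEq V] (G : SimpleGraph V)
    [DecidableRel G.Adj] : ℝ :=
  sInf {μ : ℝ | Module.End.HasEigenvalue (Matrix.toLin' (G.adjMatrix ℝ)) μ}

theorem lambdaMin_isLeast {V : Type*} [Fintype V] [DecidableEq V] [Nonempty V]
    (G : SimpleGraph V) [DecidableRel G.Adj] :
    IsLeast {μ : ℝ | Module.End.HasEigenvalue (Matrix.toLin' (G.adjMatrix ℝ)) μ}
      (lambdaMin G) := by
  have hfin : {μ : ℝ | Module.End.HasEigenvalue (Matrix.toLin' (G.adjMatrix ℝ)) μ}.Finite :=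
    Module.End.finite_hasEigenvalue _
  have hne : {μ : ℝ | Module.End.HasEigenvalue (Matrix.toLin' (G.adjMatrix ℝ)) μ}.Nonempty := by
    have hA : (G.adjMatrix ℝ).IsHermitian := by
      rw [Matrix.IsHermitian, Matrix.conjTranspose_eq_transpose_of_trivial]
      exact G.isSymm_adjMatrix
    obtain ⟨v⟩ := ‹Nonempty V›
    refine ⟨hA.eigenvalues v, ?_⟩
    have h := hA.eigenvalues_mem_spectrum_real v
    rw [← Matrix.spectrum_toLin'] at h
    exact Module.End.hasEigenvalue_iff_mem_spectrum.mpr h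
  exact ⟨hne.csInf_mem hfin, fun _ hx => csInf_le hfin.bddBelow hx⟩

/-- The fan at one vertex is a triangulation. -/
theorem nonempty_triangulation {n : ℕ} (hn : 4 ≤ n) : Nonempty (Triangulation n) := by
  let f : Fin (n - 3) → Diagonal n := fun j =>
    ⟨(⟨0, by omega⟩, ⟨j + 2, by omega⟩), by simp, by simp; omega⟩
  have hf : Function.Injective f := by
    intro a b h
    simp only [f, Subtype.mk.injEq, Prod.mk.injEq, Fin.mk.injEq] at h
    exact Fin.ext (by omega)
  refine ⟨⟨Finset.univ.image f, by simp [Finset.card_image_of_injective _ hf], ?_⟩⟩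
  intro d hd e he
  obtain ⟨a, -, rfl⟩ := Finset.mem_image.mp hd
  obtain ⟨b, -, rfl⟩ := Finset.mem_image.mp he
  simp [f, Diagonal.Crosses]

/-! Fix a diagonal cutting an `n`-gon into a `k`-gon and an `l`-gon, so `n + 2 = k + l`. The
triangulations containing it induce the box product of the two smaller flip graphs. Passing to an
induced subgraph cannot lower the least eigenvalue, and least eigenvalues add under box products, so
`lambdaMin_associahedronGraph_glue` is subadditivity with a shift of 2. Gluing on a triangle shows
that the sequence is antitone, which absorbs the shift.

The limit then follows from Fekete's lemma once the ratio is bounded below. The bound holds because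
the adjacency matrix plus `n - 3` times the identity is a Gram matrix. -/

section SmallestEigenvalue

/-! ### Least eigenvalues, induced subgraphs and box products -/

theorem sum_adj_mul_eq {V : Type*} [Fintype V] (G : SimpleGraph V) [DecidableRel G.Adj]
    {μ : ℝ} {x : V → ℝ} (h : (G.adjMatrix ℝ).mulVec x = μ • x) :
    ∑ u, ∑ v, (if G.Adj u v then x u * x v else 0) = μ * ∑ u, x u ^ 2 := by
  rw [Finset.mul_sum]
  refine Finset.sum_congr rfl fun u _ => ?_
  have hu := congrFun h u
  simp only [Matrix.mulVec, dotProduct, SimpleGraph.adjMatrix_apply, Pi.smul_apply, smul_eq_mul,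
    ite_mul, one_mul, zero_mul] at hu
  calc _ = x u * ∑ v, (if G.Adj u v then x v else 0) := by simp [Finset.mul_sum]
    _ = _ := by rw [hu]; ring

theorem sum_sq_pos {V : Type*} [Fintype V] {x : V → ℝ} (hx : x ≠ 0) : 0 < ∑ u, x u ^ 2 := by
  obtain ⟨u, hu⟩ := Function.ne_iff.mp hx
  exact Finset.sum_pos' (fun _ _ => sq_nonneg _) ⟨u, Finset.mem_univ _, sq_pos_of_ne_zero hu⟩

variable {V W : Type*} [Fintype V] [DecidableEq V] [Fintype W] [DecidableEq W]

theorem lambdaMin_le_of_mulVec_eq (G : SimpleGraph V) [DecidableRel G.Adj] {μ : ℝ} {x : V → ℝ}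
    (hx : x ≠ 0) (h : (G.adjMatrix ℝ).mulVec x = μ • x) : lambdaMin G ≤ μ := by
  have : Nonempty V := by
    by_contra hV
    rw [not_nonempty_iff] at hV
    exact hx (Subsingleton.elim _ _)
  refine (lambdaMin_isLeast G).2 ?_
  refine Module.End.hasEigenvalue_of_hasEigenvector (x := x) ⟨?_, hx⟩
  rw [Module.End.mem_eigenspace_iff, Matrix.toLin'_apply, h]

theorem exists_mulVec_eq_lambdaMin [Nonempty V] (G : SimpleGraph V) [DecidableRel G.Adj] :
    ∃ x : V → ℝ, x ≠ 0 ∧ (G.adjMatrix ℝ).mulVec x = lambdaMin G • x := by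
  obtain ⟨x, hx⟩ := (lambdaMin_isLeast G).1.exists_hasEigenvector
  refine ⟨x, hx.2, ?_⟩
  rw [← Matrix.toLin'_apply, hx.apply_eq_smul]

/-- Rayleigh's inequality: subtracting the least eigenvalue from the diagonal leaves a symmetric
matrix with nonnegative spectrum. -/
theorem lambdaMin_mul_sum_sq_le (G : SimpleGraph V) [DecidableRel G.Adj] (z : V → ℝ) :
    lambdaMin G * ∑ u, z u ^ 2 ≤ ∑ u, ∑ v, if G.Adj u v then z u * z v else 0 := by
  set A := G.adjMatrix ℝ
  set B : Matrix V V ℝ := A - lambdaMin G • (1 : Matrix V V ℝ)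
  have hA : A.IsHermitian := by
    rw [Matrix.IsHermitian, Matrix.conjTranspose_eq_transpose_of_trivial]
    exact G.isSymm_adjMatrix
  have hB : B.IsHermitian := by
    refine hA.sub ?_
    rw [Matrix.IsHermitian, Matrix.conjTranspose_smul, Matrix.conjTranspose_one, star_trivial]
  have hpos : B.PosSemidef := by
    rw [hB.posSemidef_iff_eigenvalues_nonneg]
    intro i
    have hv := hB.mulVec_eigenvectorBasis i
    have hne : (hB.eigenvectorBasis i : V → ℝ) ≠ 0 := by
      intro h
      apply hB.eigenvectorBasis.toBasis.ne_zero i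
      ext j
      simpa using congrFun h j
    have := lambdaMin_le_of_mulVec_eq G (μ := hB.eigenvalues i + lambdaMin G) hne (by
      rw [add_smul, ← hv]
      simp only [B, Matrix.sub_mulVec, Matrix.smul_mulVec, Matrix.one_mulVec, sub_add_cancel]
      rfl)
    simp only [Pi.zero_apply]
    linarith
  have h := hpos.dotProduct_mulVec_nonneg z
  simp only [B, Matrix.sub_mulVec, Matrix.smul_mulVec, Matrix.one_mulVec, star_trivial,
    dotProduct_sub, dotProduct_smul, smul_eq_mul] at h
  have h1 : z ⬝ᵥ z = ∑ u, z u ^ 2 := by simp [dotProduct, sq]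
  have h2 : z ⬝ᵥ A.mulVec z = ∑ u, ∑ v, if G.Adj u v then z u * z v else 0 := by
    simp [dotProduct, Matrix.mulVec, A, SimpleGraph.adjMatrix_apply, Finset.mul_sum]
  rw [h1, h2] at h
  linarith

/-- Extending an eigenvector by zero preserves both its norm and, since the subgraph is induced, its
quadratic form. -/
theorem lambdaMin_le_of_embedding [Nonempty V] {G : SimpleGraph V} {H : SimpleGraph W}
    [DecidableRel G.Adj] [DecidableRel H.Adj] (φ : G ↪g H) : lambdaMin H ≤ lambdaMin G := by
  obtain ⟨x, hx, hGx⟩ := exists_mulVec_eq_lambdaMin G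
  set z : W → ℝ := Function.extend φ x 0
  have hz : ∀ p, z (φ p) = x p := fun p => φ.injective.extend_apply _ _ _
  have hz0 : ∀ u ∉ Set.range φ, z u = 0 := fun u hu => Function.extend_apply' _ _ _ hu
  have hsq : ∑ p, x p ^ 2 = ∑ u, z u ^ 2 :=
    Fintype.sum_of_injective φ φ.injective _ _ (fun u hu => by simp [hz0 u hu])
      (fun p => by rw [hz])
  have hadj : ∑ p, ∑ q, (if G.Adj p q then x p * x q else 0) =
      ∑ u, ∑ v, if H.Adj u v then z u * z v else 0 :=
    Fintype.sum_of_injective φ φ.injective _ _ (fun u hu => by simp [hz0 u hu]) fun p =>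
      Fintype.sum_of_injective φ φ.injective _ _ (fun u hu => by simp [hz0 u hu])
        (fun q => by simp only [hz, φ.map_adj_iff])
  have h := lambdaMin_mul_sum_sq_le H z
  rw [← hsq, ← hadj, sum_adj_mul_eq G hGx] at h
  exact le_of_mul_le_mul_right h (sum_sq_pos hx)

/-- The tensor product of two eigenvectors is an eigenvector for the sum of their eigenvalues. -/
theorem lambdaMin_boxProd_le [Nonempty V] [Nonempty W] (G : SimpleGraph V) (H : SimpleGraph W)
    [DecidableRel G.Adj] [DecidableRel H.Adj] [DecidableRel (G.boxProd H).Adj] :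
    lambdaMin (G.boxProd H) ≤ lambdaMin G + lambdaMin H := by
  obtain ⟨x, hx, hGx⟩ := exists_mulVec_eq_lambdaMin G
  obtain ⟨y, hy, hHy⟩ := exists_mulVec_eq_lambdaMin H
  obtain ⟨u, hu⟩ := Function.ne_iff.mp hx
  obtain ⟨v, hv⟩ := Function.ne_iff.mp hy
  refine lambdaMin_le_of_mulVec_eq (x := fun p : V × W => x p.1 * y p.2) _
    (Function.ne_iff.mpr ⟨(u, v), mul_ne_zero hu hv⟩) ?_
  ext ⟨a, b⟩
  have ha := congrFun hGx a
  have hb := congrFun hHy b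
  simp only [Matrix.mulVec, dotProduct, SimpleGraph.adjMatrix_apply, Pi.smul_apply, smul_eq_mul,
    ite_mul, one_mul, zero_mul] at ha hb ⊢
  have key : ∀ c d, (if (G.boxProd H).Adj (a, b) (c, d) then x c * y d else 0) =
      (if b = d then (if G.Adj a c then x c else 0) * y d else 0) +
      (if a = c then x c * (if H.Adj b d then y d else 0) else 0) := by
    intro c d
    by_cases hbd : b = d <;> by_cases hac : a = c <;>
      simp [SimpleGraph.boxProd_adj, hbd, hac]
  rw [Fintype.sum_prod_type]
  simp only [key, Finset.sum_add_distrib]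
  rw [Finset.sum_comm (f := fun c d => if a = c then x c * (if H.Adj b d then y d else 0) else 0)]
  simp only [Finset.sum_ite_eq, Finset.mem_univ, if_true, ← Finset.sum_mul, ← Finset.mul_sum,
    ha, hb]
  ring

theorem lambdaMin_le_add_of_embedding {U : Type*} [Fintype U] [DecidableEq U] [Nonempty V]
    [Nonempty W] {G : SimpleGraph V} {H : SimpleGraph W} {K : SimpleGraph U} [DecidableRel G.Adj]
    [DecidableRel H.Adj] [DecidableRel K.Adj] (φ : G.boxProd H ↪g K) :
    lambdaMin K ≤ lambdaMin G + lambdaMin H := by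
  have : DecidableRel (G.boxProd H).Adj := Classical.decRel _
  exact (lambdaMin_le_of_embedding φ).trans (lambdaMin_boxProd_le G H)

theorem lambdaMin_eq_zero_of_subsingleton [Subsingleton V] [Nonempty V] (G : SimpleGraph V)
    [DecidableRel G.Adj] : lambdaMin G = 0 := by
  obtain ⟨x, hx, h⟩ := exists_mulVec_eq_lambdaMin G
  have hadj : ∀ u v, ¬ G.Adj u v := fun u v h => h.ne (Subsingleton.elim u v)
  have h' := sum_adj_mul_eq G h
  simp only [hadj, if_false, Finset.sum_const_zero] at h'
  exact (mul_eq_zero.mp h'.symm).resolve_right (sum_sq_pos hx).ne'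

end SmallestEigenvalue

/-! ### Linear lower bound and degenerate polygons -/

theorem triangulation_eq_of_card_inter {n : ℕ} {S T : Triangulation n}
    (h : n - 3 ≤ (S.1 ∩ T.1).card) : S = T := by
  refine Subtype.ext (Finset.eq_of_subset_of_card_le (Finset.inter_eq_left.mp ?_)
    (by rw [S.2.1, T.2.1]))
  exact Finset.eq_of_subset_of_card_le Finset.inter_subset_left (by rw [S.2.1]; exact h)

theorem card_inter_lt_of_ne {n : ℕ} {S T : Triangulation n} (h : S ≠ T) :
    (S.1 ∩ T.1).card < n - 3 :=
  lt_of_not_ge fun h' => h (triangulation_eq_of_card_inter h')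

/-- If `N` is the incidence matrix of `(n - 4)`-sets of diagonals against the triangulations
containing them, then `NᵀN` is the adjacency matrix plus `n - 3` times the identity. It is positive
semidefinite. -/
theorem neg_le_lambdaMin_associahedronGraph {n : ℕ} (hn : 4 ≤ n) :
    -(n : ℝ) ≤ lambdaMin (associahedronGraph n) := by
  have := nonempty_triangulation hn
  obtain ⟨x, hx, h⟩ := exists_mulVec_eq_lambdaMin (associahedronGraph n)
  have hsum := sum_adj_mul_eq _ h
  -- The entries of `NᵀN`: distinct triangulations share at most `n - 4` diagonals, hence at most
  -- one such subset, and exactly one when they are adjacent.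
  have hcard : ∀ S T : Triangulation n,
      ((S.1 ∩ T.1).powersetCard (n - 4)).card =
        (if (associahedronGraph n).Adj S T then 1 else 0) + if S = T then n - 3 else 0 := by
    intro S T
    rw [Finset.card_powersetCard]
    by_cases hST : S = T
    · subst hST
      simp only [Finset.inter_self, S.2.1, SimpleGraph.irrefl, if_false, if_true, zero_add]
      obtain ⟨m, rfl⟩ := Nat.exists_eq_add_of_le' hn
      simp [show m + 4 - 3 = m + 1 by omega]
    · have hlt := card_inter_lt_of_ne hST
      by_cases hc : (S.1 ∩ T.1).card = n - 4
      · simp [associahedronGraph, hST, hc]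
      · rw [Nat.choose_eq_zero_of_lt (by omega)]
        simp [associahedronGraph, hST, hc]
  have hsq : ∑ R ∈ (Finset.univ : Finset (Diagonal n)).powersetCard (n - 4),
      (∑ S : Triangulation n, if R ⊆ S.1 then x S else 0) ^ 2 =
      (lambdaMin (associahedronGraph n) + ((n - 3 : ℕ) : ℝ)) * ∑ S, x S ^ 2 := by
    calc _ = ∑ S : Triangulation n, ∑ T : Triangulation n,
          (((S.1 ∩ T.1).powersetCard (n - 4)).card : ℝ) * (x S * x T) := by
          simp only [sq, Finset.sum_mul_sum]
          rw [Finset.sum_comm]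
          refine Finset.sum_congr rfl fun S _ => ?_
          rw [Finset.sum_comm]
          refine Finset.sum_congr rfl fun T _ => ?_
          have hfil : (S.1 ∩ T.1).powersetCard (n - 4) =
              ((Finset.univ : Finset (Diagonal n)).powersetCard (n - 4)).filter
                fun R => R ⊆ S.1 ∧ R ⊆ T.1 := by
            ext R
            simp [Finset.mem_powersetCard, Finset.subset_inter_iff, and_comm]
          rw [hfil, ← nsmul_eq_mul, ← Finset.sum_const, Finset.sum_filter]
          refine Finset.sum_congr rfl fun R _ => ?_
          by_cases h1 : R ⊆ S.1 <;> by_cases h2 : R ⊆ T.1 <;> simp [h1, h2]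
      _ = _ := by
          simp only [hcard, Nat.cast_add, Nat.cast_ite, Nat.cast_one, Nat.cast_zero, add_mul,
            ite_mul, one_mul, zero_mul, Finset.sum_add_distrib, Finset.sum_ite_eq,
            Finset.mem_univ, if_true]
          rw [hsum, Finset.mul_sum (a := ((n - 3 : ℕ) : ℝ))]
          simp only [sq]
  have hnn : 0 ≤ (lambdaMin (associahedronGraph n) + ((n - 3 : ℕ) : ℝ)) * ∑ S, x S ^ 2 := by
    rw [← hsq]
    exact Finset.sum_nonneg fun _ _ => sq_nonneg _
  have h1 := nonneg_of_mul_nonneg_left hnn (sum_sq_pos hx)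
  have h2 : ((n - 3 : ℕ) : ℝ) ≤ n := by exact_mod_cast Nat.sub_le n 3
  linarith

theorem isEmpty_diagonal {n : ℕ} (hn : n ≤ 3) : IsEmpty (Diagonal n) := by
  refine ⟨fun ⟨⟨i, j⟩, h1, h2⟩ => ?_⟩
  simp only at h1 h2
  omega

theorem nonempty_triangulation_of_nat (n : ℕ) : Nonempty (Triangulation n) := by
  rcases le_or_gt 4 n with hn | hn
  · exact nonempty_triangulation hn
  · exact ⟨⟨∅, by rw [Finset.card_empty]; omega, by simp⟩⟩

/-- Here `n - 3` truncates to 0, so the empty set is the only triangulation. The case `n = 3` is the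
triangle used for gluing; the others let subadditivity hold on all of `ℕ`. -/
theorem lambdaMin_associahedronGraph_of_le_three {n : ℕ} (hn : n ≤ 3) :
    lambdaMin (associahedronGraph n) = 0 := by
  have := isEmpty_diagonal hn
  have := nonempty_triangulation_of_nat n
  exact lambdaMin_eq_zero_of_subsingleton _

/-! ### Gluing polygons along a side -/

section Gluing

variable {a b : ℕ}

/-- The diagonals of the `(a + b)`-gon obtained by gluing an `(a + 1)`-gon on the vertices
`0, …, a` to a `(b + 1)`-gon on the vertices `0, a, …, a + b - 1`; `none` is the common side. -/
def glueDiagonal (ha : 2 ≤ a) (hb : 2 ≤ b) :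
    Option (Diagonal (a + 1) ⊕ Diagonal (b + 1)) → Diagonal (a + b)
  | none => ⟨(⟨0, by omega⟩, ⟨a, by omega⟩), by simp only; omega⟩
  | some (.inl d) => ⟨(⟨d.1.1, by omega⟩, ⟨d.1.2, by omega⟩), by
      have := d.2; simp only; omega⟩
  -- Vertex 0 stays fixed and vertex `i ≥ 1` moves to `a - 1 + i`, so the side from 0 to 1 becomes
  -- the common side from 0 to `a`.
  | some (.inr d) => ⟨(⟨if (d.1.1 : ℕ) = 0 then 0 else a - 1 + d.1.1, by split_ifs <;> omega⟩,
      ⟨a - 1 + d.1.2, by omega⟩), by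
      have := d.2; simp only; split_ifs <;> omega⟩

theorem glueDiagonal_injective (ha : 2 ≤ a) (hb : 2 ≤ b) :
    Function.Injective (glueDiagonal ha hb) := by
  intro d e he
  have h1 := congrArg (fun d => (d.1.1 : ℕ)) he
  have h2 := congrArg (fun d => (d.1.2 : ℕ)) he
  clear he
  rcases d with (_ | d | d) <;> rcases e with (_ | e | e) <;> simp only [glueDiagonal] at h1 h2 <;>
    try have hd := d.2
  all_goals try have he := e.2
  · rfl
  · omega
  · omega
  · omega
  · have : d = e := Subtype.ext (Prod.ext (Fin.ext h1) (Fin.ext h2))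
    rw [this]
  · omega
  · omega
  · omega
  · have : d = e :=
      Subtype.ext (Prod.ext (Fin.ext (by split_ifs at h1 <;> omega)) (Fin.ext (by omega)))
    rw [this]

theorem not_crosses_glueDiagonal (ha : 2 ≤ a) (hb : 2 ≤ b)
    {S : Finset (Diagonal (a + 1))} {T : Finset (Diagonal (b + 1))}
    (hS : ∀ d ∈ S, ∀ e ∈ S, ¬ d.Crosses e) (hT : ∀ d ∈ T, ∀ e ∈ T, ¬ d.Crosses e)
    {d e : Option (Diagonal (a + 1) ⊕ Diagonal (b + 1))}
    (hd : d ∈ Finset.insertNone (S.disjSum T)) (he : e ∈ Finset.insertNone (S.disjSum T)) :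
    ¬ (glueDiagonal ha hb d).Crosses (glueDiagonal ha hb e) := by
  rcases d with (_ | d | d) <;> rcases e with (_ | e | e)
  case some.inl.some.inl =>
    have h := hS d (by simpa using hd) e (by simpa using he)
    simpa only [Diagonal.Crosses, glueDiagonal, Fin.lt_def] using h
  case some.inr.some.inr =>
    have h := hT d (by simpa using hd) e (by simpa using he)
    simp only [Diagonal.Crosses, glueDiagonal, Fin.lt_def] at h ⊢
    split_ifs <;> omega
  all_goals
    clear hd he
    simp only [Diagonal.Crosses, glueDiagonal, Fin.lt_def]
    try split_ifs
  all_goals omega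

/-- Glue a triangulation of an `(a + 1)`-gon and one of a `(b + 1)`-gon along a common side. -/
def glueTriangulation (ha : 2 ≤ a) (hb : 2 ≤ b)
    (p : Triangulation (a + 1) × Triangulation (b + 1)) : Triangulation (a + b) :=
  ⟨(Finset.insertNone (p.1.1.disjSum p.2.1)).map ⟨_, glueDiagonal_injective ha hb⟩, by
    rw [Finset.card_map, Finset.card_insertNone, Finset.card_disjSum, p.1.2.1, p.2.2.1]
    omega, by
    intro d hd e he
    obtain ⟨d, hd', rfl⟩ := Finset.mem_map.mp hd
    obtain ⟨e, he', rfl⟩ := Finset.mem_map.mp he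
    exact not_crosses_glueDiagonal ha hb p.1.2.2 p.2.2.2 hd' he'⟩

theorem card_glueTriangulation_inter (ha : 2 ≤ a) (hb : 2 ≤ b)
    (p q : Triangulation (a + 1) × Triangulation (b + 1)) :
    ((glueTriangulation ha hb p).1 ∩ (glueTriangulation ha hb q).1).card =
      (p.1.1 ∩ q.1.1).card + (p.2.1 ∩ q.2.1).card + 1 := by
  have h : Finset.insertNone (p.1.1.disjSum p.2.1) ∩ Finset.insertNone (q.1.1.disjSum q.2.1) =
      Finset.insertNone ((p.1.1 ∩ q.1.1).disjSum (p.2.1 ∩ q.2.1)) := by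
    ext (_ | d | d) <;> simp only [Finset.mem_inter, Finset.none_mem_insertNone,
      Finset.some_mem_insertNone, Finset.inl_mem_disjSum, Finset.inr_mem_disjSum, and_self]
  simp only [glueTriangulation]
  rw [← Finset.map_inter, h, Finset.card_map, Finset.card_insertNone, Finset.card_disjSum]

/-- The product of two flip graphs is the induced subgraph of a flip graph on the
triangulations containing a given diagonal. -/
def glueEmbedding (ha : 2 ≤ a) (hb : 2 ≤ b) :
    (associahedronGraph (a + 1)).boxProd (associahedronGraph (b + 1)) ↪g
      associahedronGraph (a + b) where
  toFun := glueTriangulation ha hb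
  inj' p q h := by
    have hc := card_glueTriangulation_inter ha hb p q
    rw [← h, Finset.inter_self, (glueTriangulation ha hb p).2.1] at hc
    have h1 := Finset.card_le_card (Finset.inter_subset_left (s₁ := p.1.1) (s₂ := q.1.1))
    have h2 := Finset.card_le_card (Finset.inter_subset_left (s₁ := p.2.1) (s₂ := q.2.1))
    rw [p.1.2.1] at h1
    rw [p.2.2.1] at h2
    exact Prod.ext (triangulation_eq_of_card_inter (by omega))
      (triangulation_eq_of_card_inter (by omega))
  map_rel_iff' {p q} := by
    change (glueTriangulation ha hb p ≠ glueTriangulation ha hb q ∧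
      ((glueTriangulation ha hb p).1 ∩ (glueTriangulation ha hb q).1).card = a + b - 4) ↔ _
    have hc := card_glueTriangulation_inter ha hb p q
    rw [hc, SimpleGraph.boxProd_adj]
    obtain ⟨S, T⟩ := p
    obtain ⟨S', T'⟩ := q
    simp only [associahedronGraph] at hc ⊢
    have hS : (S.1 ∩ S.1).card = a + 1 - 3 := by rw [Finset.inter_self, S.2.1]
    have hT : (T.1 ∩ T.1).card = b + 1 - 3 := by rw [Finset.inter_self, T.2.1]
    have hglue : glueTriangulation ha hb (S, T) = glueTriangulation ha hb (S', T') →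
        (S.1 ∩ S'.1).card + (T.1 ∩ T'.1).card + 1 = a + b - 3 := fun h => by
      rw [← hc, ← h, Finset.inter_self, (glueTriangulation ha hb (S, T)).2.1]
    by_cases h1 : S = S' <;> by_cases h2 : T = T'
    · subst h1 h2
      simp
    · subst h1
      have := card_inter_lt_of_ne h2
      simp only [ne_eq, h2, not_true_eq_false, not_false_eq_true, false_and, true_and, and_true,
        and_false, false_or]
      grind
    · subst h2
      have := card_inter_lt_of_ne h1
      simp only [ne_eq, h1, not_true_eq_false, not_false_eq_true, false_and, true_and, and_true,
        or_false]
      grind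
    -- When both halves change, at least two diagonals are lost, too many for a single flip.
    · have := card_inter_lt_of_ne h1
      have := card_inter_lt_of_ne h2
      simp only [h1, h2, and_false, or_false, iff_false]
      omega

end Gluing

/-! ### Monotonicity, subadditivity and the limit -/

theorem lambdaMin_associahedronGraph_glue {k l n : ℕ} (hk : 3 ≤ k) (hl : 3 ≤ l)
    (hn : n + 2 = k + l) : lambdaMin (associahedronGraph n) ≤
      lambdaMin (associahedronGraph k) + lambdaMin (associahedronGraph l) := by
  have := nonempty_triangulation_of_nat k
  have := nonempty_triangulation_of_nat l
  obtain ⟨φ⟩ : Nonempty ((associahedronGraph k).boxProd (associahedronGraph l) ↪g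
      associahedronGraph n) := by
    obtain ⟨a, rfl⟩ := Nat.exists_eq_add_of_le' (show 1 ≤ k by omega)
    obtain ⟨b, rfl⟩ := Nat.exists_eq_add_of_le' (show 1 ≤ l by omega)
    obtain rfl : n = a + b := by omega
    exact ⟨glueEmbedding (by omega) (by omega)⟩
  exact lambdaMin_le_add_of_embedding φ

/-- Gluing on a triangle adds one vertex to the polygon and contributes eigenvalue 0. -/
theorem antitone_lambdaMin_associahedronGraph :
    Antitone fun n : ℕ => lambdaMin (associahedronGraph n) := by
  refine antitone_nat_of_succ_le fun n => ?_
  beta_reduce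
  generalize hm : n + 1 = m
  rcases le_or_gt n 2 with hn | hn
  · rw [lambdaMin_associahedronGraph_of_le_three (by omega : n ≤ 3),
      lambdaMin_associahedronGraph_of_le_three (by omega : m ≤ 3)]
  · obtain ⟨l, hl⟩ : ∃ l, l = 3 := ⟨3, rfl⟩
    have h := lambdaMin_associahedronGraph_glue (n := m) hn hl.ge (by omega)
    rwa [lambdaMin_associahedronGraph_of_le_three hl.le, add_zero] at h

theorem subadditive_lambdaMin_associahedronGraph :
    Subadditive fun n : ℕ => lambdaMin (associahedronGraph n) := by
  intro k l
  beta_reduce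
  -- A polygon too small to be glued has value 0, so monotonicity alone suffices.
  rcases le_or_gt k 2 with hk | hk
  · rw [lambdaMin_associahedronGraph_of_le_three (by omega : k ≤ 3), zero_add]
    exact antitone_lambdaMin_associahedronGraph (Nat.le_add_left l k)
  rcases le_or_gt l 2 with hl | hl
  · rw [lambdaMin_associahedronGraph_of_le_three (by omega : l ≤ 3), add_zero]
    exact antitone_lambdaMin_associahedronGraph (Nat.le_add_right k l)
  exact (antitone_lambdaMin_associahedronGraph (Nat.sub_le (k + l) 2)).trans
    (lambdaMin_associahedronGraph_glue hk hl (by omega))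

theorem proposition4p1 :
    (∀ k ℓ : ℕ, 4 ≤ k → 4 ≤ ℓ →
      lambdaMin (associahedronGraph (k + ℓ)) ≤
        lambdaMin (associahedronGraph k) + lambdaMin (associahedronGraph ℓ)) ∧
    ∃ L : ℝ, Tendsto (fun n : ℕ => lambdaMin (associahedronGraph n) / (n : ℝ)) atTop (𝓝 L) := by
  refine ⟨fun k ℓ _ _ => subadditive_lambdaMin_associahedronGraph k ℓ, _,
    -- Fekete's lemma; `-1` bounds every ratio from below, including the ratio 0 for `n ≤ 3`.
    subadditive_lambdaMin_associahedronGraph.tendsto_lim ⟨-1, ?_⟩⟩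
  rintro _ ⟨n, rfl⟩
  rcases le_or_gt 4 n with hn | hn
  · have hn' : (0 : ℝ) < n := by exact_mod_cast (by omega : 0 < n)
    simp only
    rw [le_div_iff₀ hn']
    linarith [neg_le_lambdaMin_associahedronGraph hn]
  · simp only
    rw [lambdaMin_associahedronGraph_of_le_three (by omega : n ≤ 3), zero_div]
    norm_num
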